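/- Let $n\ge 1$ and let $H=H(q,y):\mathbb R^n\times\mathbb R^n\to\mathbb R$ satisfy: (i) $q\mapsto H(q,y)$ is convex for every $y$; (ii) $\lim_{|q|\to\infty}\inf_{y\in\mathbb R^n}H(q,y)=+\infty$; (iii) for every $R>0$, $H$ is uniformly continuous and bounded on $B_R\times\mathbb R^n$, where $B_R=\{q:|q|<R\}$. For $p\in\mathbb R^n$ let $\overline H(p)$ be the infimum of all $\mu\in\mathbb R$ for which there is a (globally) Lipschitz function $w:\mathbb R^n\to\mathbb R$ that is a viscosity subsolution of $H(p+Dw,y)\le\mu$ in $\mathbb R^n$ and satisfies $\lim_{|y|\to\infty}|y|^{-1}w(y)=0$. Then for all $p\in\mathbb R^n$, $\mu>\overline H(p)$ and $x_0\in\mathbb R^n$ there is exactly one continuous function $d:\mathbb R^n\to\mathbb R$ that is a viscosity solution of $$H(p+Dd,y)=\mu\quad\text{in }\mathbb R^n\setminus\{x_0\}$$ and satisfies $$\liminf_{|y|\to\infty}|y|^{-1}d(y)>0\quad\text{and}\quad d(x_0)=0.$$ -/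

import Mathlib

open Filter Topology Set

/-- `u` is a viscosity subsolution of `F(Du, y) ≤ μ` in `U`: it is upper semicontinuous on `U`, and
`F(Dφ(x), x) ≤ μ` whenever `x ∈ U`, `φ` is `C¹` near `x`, and `u - φ` has a local maximum at `x`.
It is used for open `U` only. -/
def IsViscositySubsolution {n : ℕ}
    (F : EuclideanSpace ℝ (Fin n) → EuclideanSpace ℝ (Fin n) → ℝ) (μ : ℝ)
    (U : Set (EuclideanSpace ℝ (Fin n))) (u : EuclideanSpace ℝ (Fin n) → ℝ) : Prop :=
  UpperSemicontinuousOn u U ∧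
    ∀ x ∈ U, ∀ φ : EuclideanSpace ℝ (Fin n) → ℝ, ContDiffAt ℝ 1 φ x →
      IsLocalMax (fun y => u y - φ y) x → F (gradient φ x) x ≤ μ

/-- `u` is a viscosity supersolution of `F(Du, y) ≥ μ` in `U`: it is lower semicontinuous on `U`,
and `F(Dφ(x), x) ≥ μ` whenever `x ∈ U`, `φ` is `C¹` near `x`, and `u - φ` has a local minimum
at `x`. It is used for open `U` only. -/
def IsViscositySupersolution {n : ℕ}
    (F : EuclideanSpace ℝ (Fin n) → EuclideanSpace ℝ (Fin n) → ℝ) (μ : ℝ)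
    (U : Set (EuclideanSpace ℝ (Fin n))) (u : EuclideanSpace ℝ (Fin n) → ℝ) : Prop :=
  LowerSemicontinuousOn u U ∧
    ∀ x ∈ U, ∀ φ : EuclideanSpace ℝ (Fin n) → ℝ, ContDiffAt ℝ 1 φ x →
      IsLocalMin (fun y => u y - φ y) x → μ ≤ F (gradient φ x) x

/-- `u` is a viscosity solution of `F(Du, y) = μ` in `U`. -/
def IsViscositySolution {n : ℕ}
    (F : EuclideanSpace ℝ (Fin n) → EuclideanSpace ℝ (Fin n) → ℝ) (μ : ℝ)
    (U : Set (EuclideanSpace ℝ (Fin n))) (u : EuclideanSpace ℝ (Fin n) → ℝ) : Prop :=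
  IsViscositySubsolution F μ U u ∧ IsViscositySupersolution F μ U u

/-- The effective Hamiltonian: the infimum of the `μ` for which `H(p + Dw, y) ≤ μ` has a global
Lipschitz viscosity subsolution `w` with `w(y) / |y| → 0` as `|y| → ∞`. For `H` coercive and
bounded on `B_R × ℝⁿ` for each `R`, this set of `μ` is nonempty and bounded below. -/
noncomputable def effectiveHamiltonian {n : ℕ}
    (H : EuclideanSpace ℝ (Fin n) → EuclideanSpace ℝ (Fin n) → ℝ)
    (p : EuclideanSpace ℝ (Fin n)) : ℝ :=
  sInf {μ : ℝ | ∃ w : EuclideanSpace ℝ (Fin n) → ℝ,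
    (∃ K : NNReal, LipschitzWith K w) ∧
    IsViscositySubsolution (fun q y => H (p + q) y) μ univ w ∧
    Tendsto (fun y => ‖y‖⁻¹ * w y) (cocompact (EuclideanSpace ℝ (Fin n))) (𝓝 0)}

/-! ### Gradients of test functions -/

/-! Coercivity bounds the gradients allowed at level `μ` by some `L`, so every continuous
subsolution off `x₀` is globally `L`-Lipschitz (`IsViscositySubsolution.sub_le_mul_norm`). Since `μ`
exceeds the effective Hamiltonian, there is a sublinear subsolution `w` at a level below `μ`. Adding
`δ * truncatedNorm κ` with small `δ` keeps it strict, uniformly in `κ`.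

Existence is Perron's method: the supremum of the subsolutions vanishing at `x₀` is finite by the
Lipschitz bound and solves the equation. It lies above the normalised `w + δ * truncatedNorm 0`,
which gives the linear growth.

Uniqueness is a comparison `u ≤ v`. By convexity `θ u + (1 - θ) w` is a strict subsolution, so if `v
- θ u - (1 - θ) w` tends to infinity, its minimum is attained at `x₀`
(`IsViscositySupersolution.comparison_convex_combination`, by doubling variables). For small `θ` the
growth of `v` suffices. Using `w + δ * truncatedNorm κ`, bounded up to `w`, and letting `κ → 0`
turns the conclusion into a better lower bound on `v - θ u`, of linear growth about `(1 - θ) δ`.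
This permits a slightly larger `θ`, and a continuity argument reaches `θ = 1`. -/

section TruncatedNorm

variable {E : Type*} [NormedAddCommGroup E]

/-- For `κ = 0` this is the smooth norm `√(1 + |y|²)`; for `κ > 0` it is bounded by `1 / κ`. -/
noncomputable def truncatedNorm (κ : ℝ) (y : E) : ℝ :=
  √(1 + ‖y‖ ^ 2) / (1 + κ * √(1 + ‖y‖ ^ 2))

theorem truncatedNorm_le_inv {κ : ℝ} (hκ : 0 < κ) (y : E) : truncatedNorm κ y ≤ κ⁻¹ := by
  rw [truncatedNorm, div_le_iff₀ (by positivity), mul_add, ← mul_assoc, inv_mul_cancel₀ hκ.ne']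
  have : 0 < κ⁻¹ := inv_pos.2 hκ
  linarith

theorem norm_le_truncatedNorm_zero (y : E) : ‖y‖ ≤ truncatedNorm 0 y := by
  simpa [truncatedNorm] using Real.le_sqrt_of_sq_le (by linarith : ‖y‖ ^ 2 ≤ 1 + ‖y‖ ^ 2)

theorem tendsto_truncatedNorm (y : E) :
    Tendsto (fun κ => truncatedNorm κ y) (𝓝[>] 0) (𝓝 (truncatedNorm 0 y)) := by
  have : ContinuousAt (fun κ : ℝ => truncatedNorm κ y) 0 := by
    unfold truncatedNorm
    exact continuousAt_const.div (by fun_prop) (by simp)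
  exact this.tendsto.mono_left nhdsWithin_le_nhds

end TruncatedNorm

section Gradient

variable {E : Type*} [NormedAddCommGroup E] [InnerProductSpace ℝ E]

theorem HasGradientAt.fun_add [CompleteSpace E] {f g : E → ℝ} {f' g' x : E} (hf : HasGradientAt f f' x)
    (hg : HasGradientAt g g' x) : HasGradientAt (fun y => f y + g y) (f' + g') x := by
  rw [hasGradientAt_iff_hasFDerivAt] at *
  rw [map_add]
  exact hf.add hg

theorem HasGradientAt.comp_hasDerivAt [CompleteSpace E] {f : E → ℝ} {f' x : E} {g : ℝ → ℝ} {g' : ℝ}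
    (hf : HasGradientAt f f' x) (hg : HasDerivAt g g' (f x)) :
    HasGradientAt (fun y => g (f y)) (g' • f') x := by
  rw [hasGradientAt_iff_hasFDerivAt] at *
  rw [map_smul]
  exact hg.comp_hasFDerivAt x hf

theorem HasGradientAt.fun_const_mul [CompleteSpace E] {f : E → ℝ} {f' x : E} (c : ℝ) (hf : HasGradientAt f f' x) :
    HasGradientAt (fun y => c * f y) (c • f') x := by
  have h : HasDerivAt (fun t : ℝ => c * t) c (f x) := by
    simpa using (hasDerivAt_id (f x)).const_mul c
  exact hf.comp_hasDerivAt h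

theorem hasGradientAt_norm_sub_sq [CompleteSpace E] (a x : E) :
    HasGradientAt (fun y => ‖y - a‖ ^ 2) ((2 : ℝ) • (x - a)) x := by
  rw [hasGradientAt_iff_hasFDerivAt]
  have h := ((hasFDerivAt_id x).sub_const a).norm_sq
  refine h.congr_fderiv ?_
  ext v
  simp [two_smul]

theorem contDiffAt_norm_sub_sq (a x : E) : ContDiffAt ℝ 1 (fun y => ‖y - a‖ ^ 2) x :=
  (contDiffAt_id.sub contDiffAt_const).norm_sq ℝ

theorem hasGradientAt_norm_sub [CompleteSpace E] {a x : E} (h : x ≠ a) :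
    HasGradientAt (fun y => ‖y - a‖) (‖x - a‖⁻¹ • (x - a)) x := by
  have h0 : ‖x - a‖ ≠ 0 := by simpa [sub_eq_zero] using h
  have h1 := (hasGradientAt_norm_sub_sq a x).comp_hasDerivAt
    (Real.hasDerivAt_sqrt (by positivity))
  simp only [Real.sqrt_sq (norm_nonneg _)] at h1
  convert h1 using 1
  rw [smul_smul]
  congr 1
  field_simp

theorem contDiffAt_norm_sub {a x : E} (h : x ≠ a) : ContDiffAt ℝ 1 (fun y => ‖y - a‖) x :=
  (contDiffAt_id.sub contDiffAt_const).norm ℝ (by simpa [sub_eq_zero] using h)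

theorem contDiff_truncatedNorm {κ : ℝ} (hκ : 0 ≤ κ) :
    ContDiff ℝ 1 (truncatedNorm κ : E → ℝ) := by
  have h : ContDiff ℝ 1 (fun y : E => √(1 + ‖y‖ ^ 2)) :=
    (contDiff_const.add (contDiff_id.norm_sq ℝ)).sqrt fun y => by positivity
  exact h.div (contDiff_const.add (contDiff_const.mul h)) fun y => by positivity

/-- With `s = √(1 + ‖x‖²)` the gradient is `x / (s (1 + κ s)²)`, and `‖x‖ ≤ s`. The bound does not
depend on `κ`, so one `δ` serves all truncations. -/
theorem hasGradientAt_truncatedNorm [CompleteSpace E] {κ : ℝ} (hκ : 0 ≤ κ) (x : E) :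
    ∃ v : E, ‖v‖ ≤ 1 ∧ HasGradientAt (truncatedNorm κ) v x := by
  have hq : HasGradientAt (fun y : E => 1 + ‖y‖ ^ 2) ((2 : ℝ) • x) x := by
    simpa using (hasGradientAt_const x (1 : ℝ)).fun_add (hasGradientAt_norm_sub_sq 0 x)
  have hpos : 0 < 1 + ‖x‖ ^ 2 := by positivity
  set s := √(1 + ‖x‖ ^ 2) with hs
  have hspos : 0 < s := Real.sqrt_pos.2 hpos
  have h1 : HasDerivAt (fun t : ℝ => √t) (1 / (2 * s)) (1 + ‖x‖ ^ 2) :=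
    Real.hasDerivAt_sqrt hpos.ne'
  have h2 : HasDerivAt (fun t : ℝ => √t / (1 + κ * √t))
      ((1 / (2 * s) * (1 + κ * s) - s * (κ * (1 / (2 * s)))) / (1 + κ * s) ^ 2)
      (1 + ‖x‖ ^ 2) :=
    h1.fun_div ((h1.const_mul κ).const_add 1) (by positivity)
  refine ⟨_, ?_, hq.comp_hasDerivAt h2⟩
  have hxs : ‖x‖ ≤ s := Real.le_sqrt_of_sq_le (by linarith)
  have hone : 1 ≤ (1 + κ * s) ^ 2 := by
    have : 0 ≤ κ * s := by positivity
    nlinarith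
  have : (1 / (2 * s) * (1 + κ * s) - s * (κ * (1 / (2 * s)))) / (1 + κ * s) ^ 2
      = 1 / (2 * s * (1 + κ * s) ^ 2) := by
    field_simp
    ring
  rw [this, smul_smul, norm_smul, Real.norm_of_nonneg (by positivity)]
  rw [div_mul_eq_mul_div, div_mul_eq_mul_div, div_le_one (by positivity)]
  nlinarith

end Gradient

/-! ### Lipschitz bound for subsolutions of coercive equations -/

section Lipschitz

/-- The slope is controlled only in the open interval; continuity recovers the left endpoint. This
allows the exceptional point `x₀` to be an endpoint. -/
theorem sub_le_mul_sub_of_slope_le {f : ℝ → ℝ} {a b K : ℝ} (hab : a ≤ b)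
    (hf : ContinuousOn f (Icc a b))
    (h : ∀ t ∈ Ioo a b, ∀ r > K, ∀ᶠ z in 𝓝[>] t, slope f t z ≤ r) :
    f b - f a ≤ K * (b - a) := by
  have key : ∀ r > K, ∀ c ∈ Ioo a b, f b - f c ≤ r * (b - c) := by
    intro r hr c hc
    have hB : ∀ x : ℝ, HasDerivAt (fun t => f c + r * (t - c)) r x := fun x => by
      simpa using (((hasDerivAt_id x).sub_const c).const_mul r).const_add (f c)
    have := image_le_of_liminf_slope_right_lt_deriv_boundary (f := f) (f' := fun _ => K)
      (a := c) (b := b) (hf.mono (Icc_subset_Icc_left hc.1.le))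
      (fun x hx s hs => by
        obtain ⟨s', hs1, hs2⟩ := exists_between hs
        exact ((h x ⟨hc.1.trans_le hx.1, hx.2⟩ s' hs1).mono
          fun z hz => hz.trans_lt hs2).frequently)
      (B := fun t => f c + r * (t - c)) (B' := fun _ => r) (by simp) hB
      (fun _ _ _ => hr) (right_mem_Icc.2 hc.2.le)
    linarith
  rcases hab.eq_or_lt with rfl | hlt
  · simp
  refine le_of_forall_gt_imp_ge_of_dense fun s hs => ?_
  have hb : 0 < b - a := sub_pos.2 hlt
  obtain ⟨r, hr1, hr2⟩ : ∃ r > K, r * (b - a) ≤ s := by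
    refine ⟨s / (b - a), ?_, by rw [div_mul_cancel₀ _ hb.ne']⟩
    exact (lt_div_iff₀ hb).2 hs
  refine le_trans ?_ hr2
  have hcl : Tendsto f (𝓝[Ioo a b] a) (𝓝 (f a)) :=
    (hf a (left_mem_Icc.2 hab)).mono_left (nhdsWithin_mono _ Ioo_subset_Icc_self)
  have hid : Tendsto (fun c : ℝ => r * (b - c)) (𝓝[Ioo a b] a) (𝓝 (r * (b - a))) :=
    (Continuous.tendsto (by fun_prop) a).mono_left nhdsWithin_le_nhds
  have : (𝓝[Ioo a b] a).NeBot := left_nhdsWithin_Ioo_neBot hlt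
  exact le_of_tendsto_of_tendsto (tendsto_const_nhds.sub hcl) hid
    (eventually_mem_nhdsWithin.mono fun c hc => key r hr1 c hc)

variable {n : ℕ} {F : EuclideanSpace ℝ (Fin n) → EuclideanSpace ℝ (Fin n) → ℝ} {μ L : ℝ}
  {U : Set (EuclideanSpace ℝ (Fin n))} {u : EuclideanSpace ℝ (Fin n) → ℝ}

/-- The function `J ‖y - x‖ + A ‖y - x‖²` has gradient of norm at least `J > L` off its vertex, so
`u` minus it can have no interior maximum except at `x`. Near `x` the margin `K - J` absorbs the
quadratic term. -/
theorem IsViscositySubsolution.eventually_sub_le_mul_norm (hL0 : 0 ≤ L)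
    (hL : ∀ q y, F q y ≤ μ → ‖q‖ ≤ L) (hU : IsOpen U) (huc : Continuous u)
    (hu : IsViscositySubsolution F μ U u) {x : EuclideanSpace ℝ (Fin n)} (hx : x ∈ U) {K : ℝ}
    (hK : L < K) : ∀ᶠ y in 𝓝 x, u y - u x ≤ K * ‖y - x‖ := by
  obtain ⟨r, hr, hrU⟩ := Metric.nhds_basis_closedBall.mem_iff.1 (hU.mem_nhds hx)
  obtain ⟨J, hJ1, hJ2⟩ := exists_between hK
  obtain ⟨z, -, hz⟩ := (isCompact_closedBall x r).exists_isMaxOn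
    ⟨x, Metric.mem_closedBall_self hr.le⟩ huc.continuousOn
  -- On the sphere of radius `r` the quadratic term alone outweighs any increase of `u` over `u x`,
  -- which rules out a maximum there.
  set A : ℝ := |u z - u x| / r ^ 2 with hA
  have hA0 : 0 ≤ A := by positivity
  have hAr : A * r ^ 2 = |u z - u x| := by rw [hA]; field_simp
  obtain ⟨y, hyB, hy⟩ := (isCompact_closedBall x r).exists_isMaxOn
    ⟨x, Metric.mem_closedBall_self hr.le⟩
    (f := fun y => u y - (J * ‖y - x‖ + A * ‖y - x‖ ^ 2)) (by fun_prop)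
  have hyx : u x ≤ u y - (J * ‖y - x‖ + A * ‖y - x‖ ^ 2) := by
    simpa using hy (Metric.mem_closedBall_self hr.le)
  have hy_eq : y = x := by
    by_contra hne
    have hnpos : 0 < ‖y - x‖ := norm_pos_iff.2 (sub_ne_zero.2 hne)
    have hlt : ‖y - x‖ < r := by
      refine lt_of_le_of_ne (by simpa [dist_eq_norm] using hyB) fun h => ?_
      have h1 : u y ≤ u z := hz hyB
      rw [h, hAr] at hyx
      nlinarith [le_abs_self (u z - u x), mul_pos (hL0.trans_lt hJ1) hr]
    have hmax : IsLocalMax (fun y => u y - (J * ‖y - x‖ + A * ‖y - x‖ ^ 2)) y :=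
      hy.isLocalMax (Metric.closedBall_mem_nhds_of_mem (by simpa [dist_eq_norm] using hlt))
    have hgrad := ((hasGradientAt_norm_sub hne).fun_const_mul J).fun_add
      ((hasGradientAt_norm_sub_sq x y).fun_const_mul A)
    have hle := hu.2 y (hrU hyB) _ ((contDiffAt_const.mul (contDiffAt_norm_sub hne)).add
      (contDiffAt_const.mul (contDiffAt_norm_sub_sq x y))) hmax
    rw [hgrad.gradient] at hle
    have hn := hL _ _ hle
    rw [smul_smul, smul_smul, ← add_smul, norm_smul, Real.norm_of_nonneg
      (by have := hL0.trans hJ1.le; positivity), add_mul, mul_assoc,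
      inv_mul_cancel₀ hnpos.ne'] at hn
    nlinarith [mul_nonneg hA0 hnpos.le]
  have hev : ∀ᶠ w in 𝓝 x, A * ‖w - x‖ < K - J := by
    have hc : ContinuousAt (fun w => A * ‖w - x‖) x := by fun_prop
    exact hc.eventually_lt continuousAt_const (by simpa using hJ2)
  filter_upwards [hev, Metric.closedBall_mem_nhds x hr] with w hw hwB
  have := hy hwB
  simp only [hy_eq, mem_ofPred_eq, sub_self, norm_zero] at this
  nlinarith [norm_nonneg (w - x)]

/-- A continuous subsolution of a coercive equation off one point is globally Lipschitz. -/
theorem IsViscositySubsolution.sub_le_mul_norm (hL0 : 0 ≤ L)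
    (hL : ∀ q y, F q y ≤ μ → ‖q‖ ≤ L) {x₀ : EuclideanSpace ℝ (Fin n)} (huc : Continuous u)
    (hu : IsViscositySubsolution F μ {x₀}ᶜ u) (a b : EuclideanSpace ℝ (Fin n)) :
    u b - u a ≤ L * ‖b - a‖ := by
  rcases eq_or_ne a b with rfl | hab
  · simp
  have hnpos : 0 < ‖b - a‖ := norm_pos_iff.2 (sub_ne_zero.2 hab.symm)
  set γ : ℝ → EuclideanSpace ℝ (Fin n) := fun t => a + t • (b - a) with hγ
  have hγc : Continuous γ := by fun_prop
  have hsub : ∀ s t : ℝ, γ t - γ s = (t - s) • (b - a) := fun s t => by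
    simp only [hγ]; module
  have hslope : ∀ t, γ t ≠ x₀ → ∀ r > L * ‖b - a‖,
      ∀ᶠ z in 𝓝[>] t, slope (u ∘ γ) t z ≤ r := by
    intro t ht r hr
    have h1 := hu.eventually_sub_le_mul_norm hL0 hL isOpen_compl_singleton huc
      (x := γ t) ht (K := r / ‖b - a‖) ((lt_div_iff₀ hnpos).2 hr)
    filter_upwards [(hγc.tendsto t).mono_left nhdsWithin_le_nhds |>.eventually h1,
      self_mem_nhdsWithin] with z hz hzt
    have hzt' : 0 < z - t := sub_pos.2 hzt
    rw [slope_def_field, div_le_iff₀ hzt']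
    rw [hsub, norm_smul, Real.norm_of_nonneg hzt'.le] at hz
    refine hz.trans (le_of_eq ?_)
    field_simp
  have hcont : Continuous (u ∘ γ) := huc.comp hγc
  have h0 : γ 0 = a := by simp [hγ]
  have h1 : γ 1 = b := by simp [hγ]
  -- The segment meets `x₀` at most once; cutting it there makes `x₀` an endpoint of both pieces.
  by_cases hex : ∃ t ∈ Icc (0 : ℝ) 1, γ t = x₀
  · obtain ⟨t, ht, htx⟩ := hex
    have hne : ∀ s, s ≠ t → γ s ≠ x₀ := fun s hs h => by
      have := hsub t s
      rw [h, htx, sub_self, eq_comm, smul_eq_zero] at this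
      rcases this with h | h
      · exact hs (sub_eq_zero.1 h)
      · exact hab (sub_eq_zero.1 h).symm
    have e1 := sub_le_mul_sub_of_slope_le ht.1 hcont.continuousOn
      fun s hs => hslope s (hne s hs.2.ne)
    have e2 := sub_le_mul_sub_of_slope_le ht.2 hcont.continuousOn
      fun s hs => hslope s (hne s hs.1.ne')
    simp only [Function.comp_apply, h0, h1] at e1 e2
    linarith
  · push Not at hex
    have e := sub_le_mul_sub_of_slope_le zero_le_one hcont.continuousOn
      fun s hs => hslope s (hex s (Ioo_subset_Icc_self hs))
    simpa [h0, h1] using e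

end Lipschitz

/-! ### Perturbation and comparison -/

section Comparison

variable {n : ℕ} {F : EuclideanSpace ℝ (Fin n) → EuclideanSpace ℝ (Fin n) → ℝ} {μ μ' L : ℝ}

theorem IsViscositySubsolution.add_contDiff {U : Set (EuclideanSpace ℝ (Fin n))}
    {w ψ : EuclideanSpace ℝ (Fin n) → ℝ} {δ : ℝ} (hw : IsViscositySubsolution F μ' U w)
    (hψ : ContDiff ℝ 1 ψ) (hgrad : ∀ x, ∃ v, ‖v‖ ≤ δ ∧ HasGradientAt ψ v x)
    (hF : ∀ q y e, F q y ≤ μ' → ‖e‖ ≤ δ → F (q + e) y ≤ μ) :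
    IsViscositySubsolution F μ U (fun y => w y + ψ y) := by
  refine ⟨hw.1.add hψ.continuous.continuousOn.upperSemicontinuousOn, fun x hx φ hφ hmax => ?_⟩
  obtain ⟨v, hv, hψv⟩ := hgrad x
  have hφ' := (hφ.differentiableAt one_ne_zero).hasGradientAt
  have h1 := hw.2 x hx (fun y => φ y + -1 * ψ y)
    (hφ.add (contDiffAt_const.mul hψ.contDiffAt)) (by
      convert hmax using 2 with y
      ring)
  rw [(hφ'.fun_add (hψv.fun_const_mul (-1))).gradient] at h1
  simpa using hF _ _ v h1 hv

/-- Coercivity confines `q` to a ball, on which the modulus of continuity is uniform in `y`. -/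
theorem exists_forall_add_le_of_uniformContinuousOn
    (huc : ∀ R : ℝ, 0 < R → UniformContinuousOn
      (fun z : EuclideanSpace ℝ (Fin n) × EuclideanSpace ℝ (Fin n) => F z.1 z.2)
      (Metric.ball 0 R ×ˢ univ))
    (hL0 : 0 ≤ L) (hL : ∀ q y, F q y ≤ μ' → ‖q‖ ≤ L) (hμ : μ' < μ) :
    ∃ δ > 0, ∀ q y e, F q y ≤ μ' → ‖e‖ ≤ δ → F (q + e) y ≤ μ := by
  obtain ⟨δ, hδ, h⟩ := Metric.uniformContinuousOn_iff.1 (huc (L + 2) (by linarith)) (μ - μ')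
    (sub_pos.2 hμ)
  refine ⟨min (δ / 2) 1, by positivity, fun q y e hq he => ?_⟩
  have hqL := hL q y hq
  have he1 : ‖e‖ ≤ δ / 2 := he.trans (min_le_left _ _)
  have he2 : ‖e‖ ≤ 1 := he.trans (min_le_right _ _)
  have := h (q + e, y) ⟨by simpa using (norm_add_le q e).trans_lt (by linarith), mem_univ _⟩
    (q, y) ⟨by simpa using (by linarith : ‖q‖ < L + 2), mem_univ _⟩
    (by simpa [Prod.dist_eq, dist_eq_norm] using (by linarith : ‖e‖ < δ))
  rw [Real.dist_eq] at this
  linarith [le_abs_self (F (q + e) y - F q y)]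

variable {u v w : EuclideanSpace ℝ (Fin n) → ℝ} {x₀ : EuclideanSpace ℝ (Fin n)}

/-- Existence of a maximum point for the functional of the doubling of variables. -/
theorem exists_forall_doubling_le {θ k : ℝ} (hk : 0 < k) (hθ0 : 0 < θ) (hθ1 : θ < 1)
    (hu : ∀ a b, u b - u a ≤ L * ‖b - a‖) (hw : ∀ a b, w b - w a ≤ L * ‖b - a‖)
    (huc : Continuous u) (hvc : Continuous v) (hwc : Continuous w)
    (hlim : Tendsto (fun y => v y - θ * u y - (1 - θ) * w y)
      (cocompact (EuclideanSpace ℝ (Fin n))) atTop) (c : EuclideanSpace ℝ (Fin n)) :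
    ∃ x y z, ∀ x' y' z',
      θ * u x' + (1 - θ) * w y' - v z' - k * (θ * ‖x' - z'‖ ^ 2 + (1 - θ) * ‖y' - z'‖ ^ 2) ≤
      θ * u x + (1 - θ) * w y - v z - k * (θ * ‖x - z‖ ^ 2 + (1 - θ) * ‖y - z‖ ^ 2) := by
  set g : EuclideanSpace ℝ (Fin n) → ℝ := fun y => v y - θ * u y - (1 - θ) * w y with hg
  have hgc : Continuous g := by fun_prop
  obtain ⟨m, hm⟩ := hgc.exists_forall_le hlim
  -- Moving `x` or `y` away from `z` to distance `t` gains at most a multiple of `L t - k t² ≤ L² /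
  -- (4k)`. A triple better than `(c, c, c)` therefore has `g z ≤ B`, which bounds `z`.
  set B : ℝ := g c + L ^ 2 / (4 * k) with hB
  have hpar : ∀ t, L * t - k * t ^ 2 ≤ L ^ 2 / (4 * k) := fun t => by
    rw [le_div_iff₀ (by positivity)]
    nlinarith [sq_nonneg (L - 2 * k * t)]
  obtain ⟨R, hR⟩ : ∃ R, ∀ z, g z ≤ B → ‖z‖ ≤ R := by
    obtain ⟨K, hK, hKs⟩ := mem_cocompact.1 (hlim.eventually (eventually_gt_atTop B))
    obtain ⟨R, hR⟩ := hK.isBounded.exists_norm_le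
    refine ⟨R, fun z hz => hR z ?_⟩
    by_contra hzK
    exact (not_lt.2 hz) (hKs hzK)
  -- Once `k t > |L| + 1` the gain is at most `-t`, so `x` and `y` stay at bounded distance from
  -- `z`.
  have hfar : ∀ η : ℝ, 0 < η → ∃ T, ∀ t, 0 ≤ t → -(B - g m) ≤ η * (L * t - k * t ^ 2) → t ≤ T := by
    intro η hη
    refine ⟨(|L| + 1) / k + |B - g m| / η, fun t ht h => ?_⟩
    by_contra! hlt
    have h1 : (|L| + 1) / k < t := lt_of_le_of_lt (le_add_of_nonneg_right (by positivity)) hlt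
    have h2 : |B - g m| / η < t := lt_of_le_of_lt (le_add_of_nonneg_left (by positivity)) hlt
    rw [div_lt_iff₀ hk] at h1
    rw [div_lt_iff₀ hη] at h2
    have h3 : L * t - k * t ^ 2 ≤ -t := by nlinarith [le_abs_self L]
    nlinarith [le_abs_self (B - g m)]
  obtain ⟨T₁, hT₁⟩ := hfar θ hθ0
  obtain ⟨T₂, hT₂⟩ := hfar (1 - θ) (by linarith)
  let Φ : EuclideanSpace ℝ (Fin n) × EuclideanSpace ℝ (Fin n) × EuclideanSpace ℝ (Fin n) → ℝ :=
    fun p => θ * u p.1 + (1 - θ) * w p.2.1 - v p.2.2 -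
      k * (θ * ‖p.1 - p.2.2‖ ^ 2 + (1 - θ) * ‖p.2.1 - p.2.2‖ ^ 2)
  have hΦ : Continuous Φ := by fun_prop
  obtain ⟨⟨x, y, z⟩, hmax⟩ := hΦ.exists_forall_ge' (c, c, c) (by
    refine mem_cocompact.2 ⟨_, isCompact_closedBall 0 (R + |T₁| + |T₂|), ?_⟩
    rintro ⟨x, y, z⟩ hp
    by_contra hgt
    apply hp
    have hgt' : -g c < Φ (x, y, z) := by
      have hc : Φ (c, c, c) = -g c := by simp [Φ, hg]; ring
      simpa [hc] using hgt
    have h1 : Φ (x, y, z) ≤ -g z + θ * (L * ‖x - z‖ - k * ‖x - z‖ ^ 2) +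
        (1 - θ) * (L * ‖y - z‖ - k * ‖y - z‖ ^ 2) := by
      simp only [Φ, hg]
      nlinarith [hu z x, hw z y]
    have e1 := hpar ‖x - z‖
    have e2 := hpar ‖y - z‖
    have hP : 0 ≤ L ^ 2 / (4 * k) := by positivity
    have f1 := mul_le_mul_of_nonneg_left e1 hθ0.le
    have f2 := mul_le_mul_of_nonneg_left e2 (sub_pos.2 hθ1).le
    have f3 := mul_nonneg hθ0.le hP
    have f4 := mul_nonneg (sub_pos.2 hθ1).le hP
    have hz : ‖z‖ ≤ R := hR z (by linarith)
    have hx : ‖x - z‖ ≤ T₁ := hT₁ _ (norm_nonneg _) (by linarith [hm z])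
    have hy : ‖y - z‖ ≤ T₂ := hT₂ _ (norm_nonneg _) (by linarith [hm z])
    have hx' : ‖x‖ ≤ ‖x - z‖ + ‖z‖ := by simpa using norm_add_le (x - z) z
    have hy' : ‖y‖ ≤ ‖y - z‖ + ‖z‖ := by simpa using norm_add_le (y - z) z
    have a1 := le_abs_self T₁
    have a2 := le_abs_self T₂
    have b1 := abs_nonneg T₁
    have b2 := abs_nonneg T₂
    simp only [mem_closedBall_zero_iff, Prod.norm_def, sup_le_iff]
    exact ⟨by linarith, by linarith, by linarith⟩)
  exact ⟨x, y, z, fun x' y' z' => hmax (x', y', z')⟩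

/-- Comparison of a supersolution `v` with the convex combination of a subsolution `u` and a strict
subsolution `w`, provided the difference tends to infinity. -/
theorem IsViscositySupersolution.comparison_convex_combination
    (hconv : ∀ y, ConvexOn ℝ univ (fun q => F q y))
    (hFuc : ∀ R : ℝ, 0 < R → UniformContinuousOn
      (fun z : EuclideanSpace ℝ (Fin n) × EuclideanSpace ℝ (Fin n) => F z.1 z.2)
      (Metric.ball 0 R ×ˢ univ))
    (hL0 : 0 < L) (hL : ∀ q y, F q y ≤ μ → ‖q‖ ≤ L) (hμ : μ' < μ)
    {θ : ℝ} (hθ0 : 0 < θ) (hθ1 : θ < 1)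
    (hvs : IsViscositySupersolution F μ {x₀}ᶜ v) (hus : IsViscositySubsolution F μ {x₀}ᶜ u)
    (hws : IsViscositySubsolution F μ' univ w)
    (huc : Continuous u) (hvc : Continuous v) (hwc : Continuous w)
    (hu : ∀ a b, u b - u a ≤ L * ‖b - a‖) (hv : ∀ a b, v b - v a ≤ L * ‖b - a‖)
    (hw : ∀ a b, w b - w a ≤ L * ‖b - a‖)
    (hlim : Tendsto (fun y => v y - θ * u y - (1 - θ) * w y)
      (cocompact (EuclideanSpace ℝ (Fin n))) atTop) (c : EuclideanSpace ℝ (Fin n)) :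
    v x₀ - θ * u x₀ - (1 - θ) * w x₀ ≤ v c - θ * u c - (1 - θ) * w c := by
  by_contra! hgap
  set gap := (v x₀ - θ * u x₀ - (1 - θ) * w x₀) - (v c - θ * u c - (1 - θ) * w c) with hgapdef
  have hgap0 : 0 < gap := sub_pos.2 hgap
  have hθ' : 0 < 1 - θ := sub_pos.2 hθ1
  -- This is the strictness gained from `w`: `θ μ + (1 - θ) μ' = μ - η`. It pays for moving the base
  -- points `x` and `y` to `z`.
  set η := (1 - θ) * (μ - μ') with hη
  have hη0 : 0 < η := mul_pos hθ' (sub_pos.2 hμ)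
  obtain ⟨δ, hδ, hδF⟩ := Metric.uniformContinuousOn_iff.1 (hFuc (L + 1) (by linarith)) η hη0
  -- The first condition keeps `x` and `z` away from `x₀`; the second puts `x` and `y` within `δ` of
  -- `z`.
  obtain ⟨k, hk1, hk2, hk0⟩ : ∃ k : ℝ, 3 * L ^ 2 < k * gap ∧ L < k * δ ∧ 0 < k := by
    refine ⟨3 * L ^ 2 / gap + L / δ + 1, ?_, ?_, by positivity⟩
    · have : 3 * L ^ 2 / gap * gap = 3 * L ^ 2 := div_mul_cancel₀ _ hgap0.ne'
      have : 0 < (L / δ + 1) * gap := by positivity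
      nlinarith
    · have : L / δ * δ = L := div_mul_cancel₀ _ hδ.ne'
      have : 0 < (3 * L ^ 2 / gap + 1) * δ := by positivity
      nlinarith
  obtain ⟨x, y, z, hmax⟩ := exists_forall_doubling_le hk0 hθ0 hθ1 hu hw huc hvc hwc hlim c
  have hs : k * ‖x - z‖ ≤ L := by
    by_contra! h
    have h1 := hmax z y z
    have h2 := hu z x
    simp only [sub_self, norm_zero] at h1
    have h3 : k * ‖x - z‖ ^ 2 ≤ L * ‖x - z‖ := by
      refine le_of_mul_le_mul_left ?_ hθ0
      nlinarith
    have h4 : 0 < ‖x - z‖ := by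
      by_contra! h0
      nlinarith
    nlinarith
  have ht : k * ‖y - z‖ ≤ L := by
    by_contra! h
    have h1 := hmax x z z
    have h2 := hw z y
    simp only [sub_self, norm_zero] at h1
    have h3 : k * ‖y - z‖ ^ 2 ≤ L * ‖y - z‖ := by
      refine le_of_mul_le_mul_left ?_ hθ'
      nlinarith
    have h4 : 0 < ‖y - z‖ := by
      by_contra! h0
      nlinarith
    nlinarith
  have hgz : k * (v z - θ * u z - (1 - θ) * w z) ≤ k * (v c - θ * u c - (1 - θ) * w c) + L ^ 2 := by
    have h1 := hmax c c c
    simp only [sub_self, norm_zero] at h1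
    have h2 : v z - θ * u z - (1 - θ) * w z ≤ v c - θ * u c - (1 - θ) * w c
        + θ * (L * ‖x - z‖) + (1 - θ) * (L * ‖y - z‖) := by
      have := mul_le_mul_of_nonneg_left (hu z x) hθ0.le
      have := mul_le_mul_of_nonneg_left (hw z y) hθ'.le
      have : 0 ≤ k * (θ * ‖x - z‖ ^ 2 + (1 - θ) * ‖y - z‖ ^ 2) := by positivity
      linarith
    have h3 := mul_le_mul_of_nonneg_left h2 hk0.le
    have h4 : θ * L * (k * ‖x - z‖) ≤ θ * L * L :=
      mul_le_mul_of_nonneg_left hs (by positivity)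
    have h5 : (1 - θ) * L * (k * ‖y - z‖) ≤ (1 - θ) * L * L :=
      mul_le_mul_of_nonneg_left ht (by positivity)
    linarith
  -- Otherwise the Lipschitz bounds would make the value at `x₀` exceed the value at `c` by at most
  -- `3 L² / k < gap`. Together with `hs` this excludes both `z = x₀` and `x = x₀`; `y = x₀` is
  -- harmless because `w` is a subsolution everywhere.
  have hfar : ¬ k * ‖x₀ - z‖ ≤ L := by
    intro h
    have h1 := hv z x₀
    have h2 := hu x₀ z
    have h3 := hw x₀ z
    rw [norm_sub_rev] at h2 h3
    have h4 : gap ≤ (v z - θ * u z - (1 - θ) * w z) - (v c - θ * u c - (1 - θ) * w c)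
        + 2 * (L * ‖x₀ - z‖) := by
      rw [hgapdef]
      have := mul_le_mul_of_nonneg_left h2 hθ0.le
      have := mul_le_mul_of_nonneg_left h3 hθ'.le
      linarith
    have h5 := mul_le_mul_of_nonneg_left h4 hk0.le
    have h6 := mul_le_mul_of_nonneg_left h hL0.le
    linarith
  have hzx₀ : z ≠ x₀ := by
    rintro rfl
    exact hfar (by simpa using hL0.le)
  have hxx₀ : x ≠ x₀ := by
    rintro rfl
    exact hfar hs
  have hgrad : ∀ a b : EuclideanSpace ℝ (Fin n), ∀ r : ℝ,
      HasGradientAt (fun y => r * ‖y - a‖ ^ 2) (r • (2 : ℝ) • (b - a)) b := fun a b r =>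
    (hasGradientAt_norm_sub_sq a b).fun_const_mul r
  have hcd : ∀ a b : EuclideanSpace ℝ (Fin n), ∀ r : ℝ,
      ContDiffAt ℝ 1 (fun y => r * ‖y - a‖ ^ 2) b := fun a b r =>
    contDiffAt_const.mul (contDiffAt_norm_sub_sq a b)
  have hFx : F (k • (2 : ℝ) • (x - z)) x ≤ μ := by
    have h := hus.2 x hxx₀ _ (hcd z x k) (Eventually.of_forall fun a => by
      have := hmax a y z
      refine le_of_mul_le_mul_left ?_ hθ0
      linarith)
    rwa [(hgrad z x k).gradient] at h
  have hFy : F (k • (2 : ℝ) • (y - z)) y ≤ μ' := by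
    have h := hws.2 y (mem_univ _) _ (hcd z y k) (Eventually.of_forall fun a => by
      have := hmax x a z
      refine le_of_mul_le_mul_left ?_ hθ'
      linarith)
    rwa [(hgrad z y k).gradient] at h
  -- The weights `θ` and `1 - θ` in the penalty make the gradient at `z` the same convex combination
  -- of the gradients at `x` and `y`.
  have hFz : μ ≤ F (θ • k • (2 : ℝ) • (x - z) + (1 - θ) • k • (2 : ℝ) • (y - z)) z := by
    have h := hvs.2 z hzx₀ _ ((hcd x z (-(k * θ))).add (hcd y z (-(k * (1 - θ)))))
      (Eventually.of_forall fun a => by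
        have := hmax x y a
        simp only [norm_sub_rev x, norm_sub_rev y] at this
        simp only
        linarith)
    rw [((hgrad x z (-(k * θ))).fun_add (hgrad y z (-(k * (1 - θ))))).gradient] at h
    convert h using 2
    module
  have hclose : ∀ a q, k * ‖a - z‖ ≤ L → F q a ≤ μ → F q z < F q a + η := by
    intro a q ha hq
    have hq' : ‖q‖ < L + 1 := (hL q a hq).trans_lt (by linarith)
    have := hδF (q, z) ⟨by simpa using hq', mem_univ _⟩ (q, a) ⟨by simpa using hq', mem_univ _⟩
      (by
        have : ‖a - z‖ < δ := lt_of_mul_lt_mul_left (ha.trans_lt hk2) hk0.le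
        rw [norm_sub_rev] at this
        simpa [Prod.dist_eq, dist_eq_norm] using this)
    rw [Real.dist_eq] at this
    linarith [le_abs_self (F q z - F q a)]
  have hcx := (hconv z).2 (mem_univ (k • (2 : ℝ) • (x - z))) (mem_univ (k • (2 : ℝ) • (y - z)))
    hθ0.le hθ'.le (by ring)
  simp only [smul_eq_mul] at hcx
  have h1 := hclose x _ hs hFx
  have h2 := hclose y _ ht (hFy.trans hμ.le)
  have h3 : θ * F (k • (2 : ℝ) • (x - z)) z < θ * (μ + η) :=
    mul_lt_mul_of_pos_left (by linarith) hθ0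
  have h4 : (1 - θ) * F (k • (2 : ℝ) • (y - z)) z < (1 - θ) * (μ' + η) :=
    mul_lt_mul_of_pos_left (by linarith) hθ'
  linarith

end Comparison

/-! ### Uniqueness -/

section Uniqueness

variable {n : ℕ} {F : EuclideanSpace ℝ (Fin n) → EuclideanSpace ℝ (Fin n) → ℝ} {μ μ' L δ : ℝ}
  {u v w : EuclideanSpace ℝ (Fin n) → ℝ} {x₀ : EuclideanSpace ℝ (Fin n)}

theorem IsViscositySubsolution.mono {U V : Set (EuclideanSpace ℝ (Fin n))}
    (hu : IsViscositySubsolution F μ' U u) (hVU : V ⊆ U) (hμ : μ' ≤ μ) :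
    IsViscositySubsolution F μ V u :=
  ⟨hu.1.mono hVU, fun x hx φ hφ hmax => (hu.2 x (hVU hx) φ hφ hmax).trans hμ⟩

theorem eventually_abs_le_mul_norm
    (hw : Tendsto (fun y => ‖y‖⁻¹ * w y) (cocompact (EuclideanSpace ℝ (Fin n))) (𝓝 0))
    {a : ℝ} (ha : 0 < a) : ∀ᶠ y in cocompact (EuclideanSpace ℝ (Fin n)), |w y| ≤ a * ‖y‖ := by
  filter_upwards [(Metric.tendsto_nhds.1 hw) a ha,
    (tendsto_norm_cocompact_atTop (E := EuclideanSpace ℝ (Fin n))).eventually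
      (eventually_gt_atTop 0)] with y hy hy0
  rw [dist_zero_right, norm_mul, norm_inv, norm_norm, Real.norm_eq_abs,
    inv_mul_lt_iff₀ hy0] at hy
  linarith

theorem eventually_le_mul_norm (C : ℝ) {a : ℝ} (ha : 0 < a) :
    ∀ᶠ y in cocompact (EuclideanSpace ℝ (Fin n)), C ≤ a * ‖y‖ :=
  ((tendsto_norm_cocompact_atTop (E := EuclideanSpace ℝ (Fin n))).const_mul_atTop ha).eventually
    (eventually_ge_atTop C)

/-- For `κ > 0` the perturbation is bounded and leaves the growth of `v - θ u` intact, so comparison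
applies. The limit `κ → 0` then yields a bound with a genuinely linear term. -/
theorem IsViscositySupersolution.ge_of_growth
    (hconv : ∀ y, ConvexOn ℝ univ (fun q => F q y))
    (hFuc : ∀ R : ℝ, 0 < R → UniformContinuousOn
      (fun z : EuclideanSpace ℝ (Fin n) × EuclideanSpace ℝ (Fin n) => F z.1 z.2)
      (Metric.ball 0 R ×ˢ univ))
    (hL0 : 0 < L) (hL : ∀ q y, F q y ≤ μ → ‖q‖ ≤ L) (hμ : μ' < μ) (hδ : 0 < δ)
    (hvs : IsViscositySupersolution F μ {x₀}ᶜ v) (hus : IsViscositySubsolution F μ {x₀}ᶜ u)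
    (hws : ∀ κ : ℝ, 0 ≤ κ →
      IsViscositySubsolution F μ' univ (fun y => w y + δ * truncatedNorm κ y))
    (huc : Continuous u) (hvc : Continuous v) (hwc : Continuous w)
    (hv : ∀ a b, v b - v a ≤ L * ‖b - a‖) (hu0 : u x₀ = 0) (hv0 : v x₀ = 0)
    (hw : Tendsto (fun y => ‖y‖⁻¹ * w y) (cocompact (EuclideanSpace ℝ (Fin n))) (𝓝 0))
    {θ : ℝ} (hθ0 : 0 < θ) (hθ1 : θ < 1) {a : ℝ} (ha : 0 < a)
    (hgrowth : ∀ᶠ y in cocompact (EuclideanSpace ℝ (Fin n)), a * ‖y‖ ≤ v y - θ * u y)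
    (y : EuclideanSpace ℝ (Fin n)) :
    θ * u y + (1 - θ) * ((w y + δ * truncatedNorm 0 y) - (w x₀ + δ * truncatedNorm 0 x₀)) ≤
      v y := by
  have hu := fun a b => hus.sub_le_mul_norm hL0.le hL huc a b
  have key : ∀ κ : ℝ, 0 < κ →
      θ * u y + (1 - θ) * ((w y + δ * truncatedNorm κ y) - (w x₀ + δ * truncatedNorm κ x₀)) ≤
        v y := by
    intro κ hκ
    have hc : Continuous (fun y => w y + δ * truncatedNorm κ y) :=
      hwc.add (continuous_const.mul (contDiff_truncatedNorm hκ.le).continuous)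
    have hs := hws κ hκ.le
    have hlim : Tendsto (fun y => v y - θ * u y - (1 - θ) * (w y + δ * truncatedNorm κ y))
        (cocompact (EuclideanSpace ℝ (Fin n))) atTop := by
      have h1 : Tendsto (fun y : EuclideanSpace ℝ (Fin n) => a / 2 * ‖y‖ + -(δ * κ⁻¹))
          (cocompact (EuclideanSpace ℝ (Fin n))) atTop :=
        tendsto_atTop_add_const_right _ _
          (tendsto_norm_cocompact_atTop.const_mul_atTop (half_pos ha))
      refine tendsto_atTop_mono' _ ?_ h1
      filter_upwards [hgrowth, eventually_abs_le_mul_norm hw (half_pos ha)] with z hz1 hz2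
      have h2 := mul_le_mul_of_nonneg_left (truncatedNorm_le_inv hκ z) hδ.le
      have h3 : w z + δ * truncatedNorm κ z ≤ a / 2 * ‖z‖ + δ * κ⁻¹ :=
        add_le_add ((le_abs_self _).trans hz2) h2
      have h4 : 0 ≤ a / 2 * ‖z‖ + δ * κ⁻¹ := by positivity
      nlinarith
    have := hvs.comparison_convex_combination hconv hFuc hL0 hL hμ hθ0 hθ1 hus hs huc hvc hc hu hv
      ((hs.mono (subset_univ _) hμ.le).sub_le_mul_norm (x₀ := x₀) hL0.le hL hc) hlim y
    rw [hu0, hv0] at this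
    linarith
  have ht := fun z : EuclideanSpace ℝ (Fin n) =>
    ((tendsto_truncatedNorm z).const_mul δ).const_add (w z)
  exact le_of_tendsto ((((ht y).sub (ht x₀)).const_mul (1 - θ)).const_add (θ * u y))
    (eventually_mem_nhdsWithin.mono fun κ hκ => key κ hκ)

/-- Subsolutions of the metric problem lie below supersolutions of positive linear growth. -/
theorem IsViscositySupersolution.ge_of_subsolution
    (hconv : ∀ y, ConvexOn ℝ univ (fun q => F q y))
    (hFuc : ∀ R : ℝ, 0 < R → UniformContinuousOn
      (fun z : EuclideanSpace ℝ (Fin n) × EuclideanSpace ℝ (Fin n) => F z.1 z.2)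
      (Metric.ball 0 R ×ˢ univ))
    (hL0 : 0 < L) (hL : ∀ q y, F q y ≤ μ → ‖q‖ ≤ L) (hμ : μ' < μ) (hδ : 0 < δ)
    (hvs : IsViscositySupersolution F μ {x₀}ᶜ v) (hus : IsViscositySubsolution F μ {x₀}ᶜ u)
    (hws : ∀ κ : ℝ, 0 ≤ κ →
      IsViscositySubsolution F μ' univ (fun y => w y + δ * truncatedNorm κ y))
    (huc : Continuous u) (hvc : Continuous v) (hwc : Continuous w)
    (hv : ∀ a b, v b - v a ≤ L * ‖b - a‖) (hu0 : u x₀ = 0) (hv0 : v x₀ = 0)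
    (hw : Tendsto (fun y => ‖y‖⁻¹ * w y) (cocompact (EuclideanSpace ℝ (Fin n))) (𝓝 0))
    {a : ℝ} (ha : 0 < a)
    (hgrowth : ∀ᶠ y in cocompact (EuclideanSpace ℝ (Fin n)), a * ‖y‖ ≤ v y) : u ≤ v := by
  have hub : ∀ y, u y ≤ L * ‖y‖ + L * ‖x₀‖ := fun y => by
    have h1 := hus.sub_le_mul_norm hL0.le hL huc x₀ y
    have h2 := mul_le_mul_of_nonneg_left (norm_sub_le y x₀) hL0.le
    rw [hu0] at h1
    linarith
  have main : ∀ θ : ℝ, 0 < θ → θ < 1 → (∃ b > 0, ∀ᶠ y in cocompact (EuclideanSpace ℝ (Fin n)),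
      b * ‖y‖ ≤ v y - θ * u y) → ∀ y, θ * u y +
        (1 - θ) * ((w y + δ * truncatedNorm 0 y) - (w x₀ + δ * truncatedNorm 0 x₀)) ≤ v y :=
    fun θ h0 h1 ⟨b, hb, hg⟩ y => hvs.ge_of_growth hconv hFuc hL0 hL hμ hδ hus hws huc hvc hwc
      hv hu0 hv0 hw h0 h1 hb hg y
  set s : Set ℝ := {θ | ∀ y, θ * u y +
    (1 - θ) * ((w y + δ * truncatedNorm 0 y) - (w x₀ + δ * truncatedNorm 0 x₀)) ≤ v y} with hs
  have hclosed : IsClosed s := by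
    rw [hs, ofPred_forall]
    exact isClosed_iInter fun y => isClosed_le (by fun_prop) continuous_const
  -- With this choice `θ₀ u` costs at most `a / 4 * (‖y‖ + ‖x₀‖)`, leaving growth `a / 2` for large
  -- `y`.
  obtain ⟨θ₀, hθ0, hθ1, hθL⟩ : ∃ θ₀ : ℝ, 0 < θ₀ ∧ θ₀ < 1 ∧ θ₀ * L ≤ a / 4 := by
    refine ⟨min (1 / 2) (a / 4 / L), by positivity, (min_le_left _ _).trans_lt (by norm_num), ?_⟩
    rw [← le_div_iff₀ hL0]
    exact min_le_right _ _
  have hmem : θ₀ ∈ s := by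
    refine main θ₀ hθ0 hθ1 ⟨a / 2, half_pos ha, ?_⟩
    filter_upwards [hgrowth, eventually_le_mul_norm ‖x₀‖ one_pos] with y h1 h2
    have h3 := mul_le_mul_of_nonneg_left (hub y) hθ0.le
    have h4 := mul_le_mul_of_nonneg_right hθL (norm_nonneg y)
    have h5 := mul_le_mul_of_nonneg_right hθL (norm_nonneg x₀)
    nlinarith
  have h1s : (1 : ℝ) ∈ s := by
    refine (hclosed.inter isClosed_Icc).mem_of_ge_of_forall_exists_gt hmem hθ1.le ?_
    rintro θ ⟨hθs, hθ⟩
    have hpos : 0 < 1 - θ := sub_pos.2 hθ.2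
    -- In units of `(1 - θ) δ ‖y‖`, membership of `θ` gives growth `1 - 1/4`, the loss being due to
    -- `w`. The increment `τ u` and the constants cost `1/4` each, so `1/4` remains.
    obtain ⟨τ, hτ0, hτ1, hτL⟩ : ∃ τ : ℝ, 0 < τ ∧ θ + τ < 1 ∧ τ * L ≤ (1 - θ) * δ / 4 := by
      refine ⟨min ((1 - θ) / 2) ((1 - θ) * δ / 4 / L), by positivity, ?_, ?_⟩
      · linarith [min_le_left ((1 - θ) / 2) ((1 - θ) * δ / 4 / L)]
      · rw [← le_div_iff₀ hL0]
        exact min_le_right _ _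
    refine ⟨θ + τ, main (θ + τ) (by linarith [hθ.1]) hτ1 ⟨(1 - θ) * δ / 4, by positivity, ?_⟩,
      by linarith, hτ1.le⟩
    filter_upwards [eventually_abs_le_mul_norm hw (a := δ / 4) (by positivity),
      eventually_le_mul_norm (τ * L * ‖x₀‖ + (1 - θ) * (w x₀ + δ * truncatedNorm 0 x₀))
        (a := (1 - θ) * δ / 4) (by positivity)] with y h1 h2
    have h3 := hθs y
    have h4 := mul_le_mul_of_nonneg_left (hub y) hτ0.le
    have h5 := mul_le_mul_of_nonneg_right hτL (norm_nonneg y)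
    have h6 : (1 - θ) * (-(δ / 4 * ‖y‖) + δ * ‖y‖) ≤ (1 - θ) * (w y + δ * truncatedNorm 0 y) := by
      refine mul_le_mul_of_nonneg_left (add_le_add ?_ ?_) hpos.le
      · linarith [neg_abs_le (w y)]
      · exact mul_le_mul_of_nonneg_left (norm_le_truncatedNorm_zero y) hδ.le
    linarith
  intro y
  simpa using h1s y

end Uniqueness

/-! ### Existence by Perron's method -/

section Perron

variable {n : ℕ} {F : EuclideanSpace ℝ (Fin n) → EuclideanSpace ℝ (Fin n) → ℝ} {μ L : ℝ}
  {d : EuclideanSpace ℝ (Fin n) → ℝ} {x₀ : EuclideanSpace ℝ (Fin n)}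

theorem ContDiffAt.continuousAt_gradient {φ : EuclideanSpace ℝ (Fin n) → ℝ}
    {x : EuclideanSpace ℝ (Fin n)} (h : ContDiffAt ℝ 1 φ x) : ContinuousAt (gradient φ) x :=
  (InnerProductSpace.toDual ℝ _).symm.continuous.continuousAt.comp
    (h.fderiv_right (m := 0) (by simp)).continuousAt

theorem hasGradientAt_add_norm_sub_sq {φ : EuclideanSpace ℝ (Fin n) → ℝ}
    {y : EuclideanSpace ℝ (Fin n)} (hφ : ContDiffAt ℝ 1 φ y) (c : ℝ)
    (x : EuclideanSpace ℝ (Fin n)) :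
    HasGradientAt (fun y => φ y + c * ‖y - x‖ ^ 2) (gradient φ y + c • (2 : ℝ) • (y - x)) y :=
  (hφ.differentiableAt one_ne_zero).hasGradientAt.fun_add
    ((hasGradientAt_norm_sub_sq x y).fun_const_mul c)

theorem contDiffAt_add_norm_sub_sq {φ : EuclideanSpace ℝ (Fin n) → ℝ}
    {y : EuclideanSpace ℝ (Fin n)} (hφ : ContDiffAt ℝ 1 φ y) (c : ℝ)
    (x : EuclideanSpace ℝ (Fin n)) : ContDiffAt ℝ 1 (fun y => φ y + c * ‖y - x‖ ^ 2) y :=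
  hφ.add (contDiffAt_const.mul (contDiffAt_norm_sub_sq x y))

theorem continuousAt_perturbed_hamiltonian (hF : Continuous (fun z :
      EuclideanSpace ℝ (Fin n) × EuclideanSpace ℝ (Fin n) => F z.1 z.2))
    {φ : EuclideanSpace ℝ (Fin n) → ℝ} {x : EuclideanSpace ℝ (Fin n)} (hφ : ContDiffAt ℝ 1 φ x)
    (c : ℝ) : ContinuousAt (fun y => F (gradient φ y + c • (2 : ℝ) • (y - x)) y) x := by
  have := hφ.continuousAt_gradient
  have h : ContinuousAt (fun y => (gradient φ y + c • (2 : ℝ) • (y - x), y)) x := by fun_prop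
  exact ContinuousAt.comp (g := fun z :
    EuclideanSpace ℝ (Fin n) × EuclideanSpace ℝ (Fin n) => F z.1 z.2) hF.continuousAt h

/-- Adding `‖y - x‖²` to the test function makes the maximum strict. A member of `S` within `r²` of
`d` at `x` then has an interior maximum in the ball, where the Hamiltonian still exceeds `μ`. -/
theorem IsViscositySubsolution.of_isLUB (hF : Continuous (fun z :
      EuclideanSpace ℝ (Fin n) × EuclideanSpace ℝ (Fin n) => F z.1 z.2))
    {U : Set (EuclideanSpace ℝ (Fin n))} (hU : IsOpen U)
    {S : Set (EuclideanSpace ℝ (Fin n) → ℝ)} (hSc : ∀ v ∈ S, Continuous v)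
    (hS : ∀ v ∈ S, IsViscositySubsolution F μ U v)
    (hd : ∀ y, IsLUB ((fun v => v y) '' S) (d y)) (hdc : Continuous d) :
    IsViscositySubsolution F μ U d := by
  refine ⟨hdc.continuousOn.upperSemicontinuousOn, fun x hx φ hφ hmax => ?_⟩
  by_contra! hlt
  have hev := (continuousAt_perturbed_hamiltonian hF hφ 1).eventually_const_lt
    (u := μ) (by simpa using hlt)
  obtain ⟨r, hr, hball⟩ := Metric.nhds_basis_closedBall.mem_iff.1
    (((hU.eventually_mem hx).and ((hφ.eventually (by simp)).and hmax)).and hev)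
  obtain ⟨_, ⟨v, hvS, rfl⟩, hv⟩ := (lt_isLUB_iff (hd x)).1 (by linarith [pow_pos hr 2] :
    d x - r ^ 2 < d x)
  have hφc : ContinuousOn φ (Metric.closedBall x r) := fun y hy =>
    (hball hy).1.2.1.continuousAt.continuousWithinAt
  have hvc := hSc v hvS
  have hcont : ContinuousOn (fun y => v y - (φ y + 1 * ‖y - x‖ ^ 2)) (Metric.closedBall x r) :=
    hvc.continuousOn.sub (hφc.add (by fun_prop))
  obtain ⟨y, hyB, hy⟩ := (isCompact_closedBall x r).exists_isMaxOn
    ⟨x, Metric.mem_closedBall_self hr.le⟩ hcont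
  obtain ⟨⟨hyU, hyφ, hyd⟩, hyF⟩ := hball hyB
  have h1 := hy (Metric.mem_closedBall_self hr.le)
  have h2 : v y ≤ d y := (hd y).1 ⟨v, hvS, rfl⟩
  simp only [mem_ofPred_eq, sub_self, norm_zero] at h1 hyd hv
  have h3 : ‖y - x‖ < r := lt_of_pow_lt_pow_left₀ 2 hr.le (by linarith)
  have h4 := (hS v hvS).2 y hyU _ (contDiffAt_add_norm_sub_sq hyφ 1 x)
    (hy.isLocalMax (Metric.closedBall_mem_nhds_of_mem (by simpa [dist_eq_norm] using h3)))
  rw [(hasGradientAt_add_norm_sub_sq hyφ 1 x).gradient] at h4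
  exact absurd h4 (not_le.2 hyF)

/-- If the supersolution property fails at `x`, the lowered and shifted test function is a strict
subsolution near `x`. Gluing it to `d` by a maximum gives a larger subsolution with the same value
at `x₀`. -/
theorem IsViscositySupersolution.of_maximal (hF : Continuous (fun z :
      EuclideanSpace ℝ (Fin n) × EuclideanSpace ℝ (Fin n) => F z.1 z.2))
    (hdc : Continuous d) (hd : IsViscositySubsolution F μ {x₀}ᶜ d)
    (hmax : ∀ v, Continuous v → v x₀ = d x₀ → IsViscositySubsolution F μ {x₀}ᶜ v → v ≤ d) :
    IsViscositySupersolution F μ {x₀}ᶜ d := by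
  refine ⟨hdc.continuousOn.lowerSemicontinuousOn, fun x hx φ hφ hmin => ?_⟩
  by_contra! hlt
  have hev := (continuousAt_perturbed_hamiltonian hF hφ (-1)).eventually_lt_const
    (u := μ) (by simpa using hlt)
  obtain ⟨r, hr, hball⟩ := Metric.nhds_basis_closedBall.mem_iff.1
    (((isOpen_compl_singleton.eventually_mem hx).and
      ((hφ.eventually (by simp)).and hmin)).and hev)
  -- The shift raises `b` above `d` at `x` by `(r / 2)²`; as `d - φ` is minimal at `x`, the
  -- quadratic term restores `b ≤ d` beyond radius `r / 2`.
  set b : EuclideanSpace ℝ (Fin n) → ℝ :=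
    fun y => (φ y + -1 * ‖y - x‖ ^ 2) + (d x - φ x + (r / 2) ^ 2) with hb
  have hbd : ∀ y ∈ Metric.closedBall x r, d y < b y → ‖y - x‖ < r / 2 := by
    intro y hy hlt'
    have h := (hball hy).1.2.2
    simp only [hb] at hlt'
    exact lt_of_pow_lt_pow_left₀ 2 (by positivity) (by linarith)
  classical
  set V : EuclideanSpace ℝ (Fin n) → ℝ :=
    fun y => if y ∈ Metric.closedBall x r then max (d y) (b y) else d y with hV
  have hVd : ∀ y, d y ≤ V y := fun y => by
    simp only [hV]
    split_ifs
    · exact le_max_left _ _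
    · exact le_rfl
  have hVb : ∀ y ∈ Metric.closedBall x r, b y ≤ V y := fun y hy => by
    simp only [hV, if_pos hy]
    exact le_max_right _ _
  have hbc : ∀ y ∈ Metric.closedBall x r, ContDiffAt ℝ 1 b y := fun y hy =>
    (contDiffAt_add_norm_sub_sq (hball hy).1.2.1 (-1) x).add contDiffAt_const
  have hVc : Continuous V := by
    refine continuous_iff_continuousAt.2 fun y => ?_
    rcases lt_or_ge ‖y - x‖ r with hy | hy
    · have hyB : y ∈ Metric.ball x r := by simpa [dist_eq_norm] using hy
      have hm : ContinuousAt (fun z => max (d z) (b z)) y :=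
        hdc.continuousAt.max (hbc y (Metric.ball_subset_closedBall hyB)).continuousAt
      refine hm.congr ?_
      filter_upwards [Metric.isOpen_ball.mem_nhds hyB] with z hz
      simp only [hV, if_pos (Metric.ball_subset_closedBall hz)]
    · have ho : IsOpen {z : EuclideanSpace ℝ (Fin n) | r / 2 < ‖z - x‖} :=
        isOpen_lt continuous_const (by fun_prop)
      refine hdc.continuousAt.congr ?_
      filter_upwards [ho.mem_nhds (show r / 2 < ‖y - x‖ by linarith)]
        with z hz
      simp only [hV]
      split_ifs with hzB
      · refine (max_eq_left ?_).symm
        by_contra! hlt'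
        exact absurd (hbd z hzB hlt') (not_lt.2 (le_of_lt hz))
      · rfl
  have hVs : IsViscositySubsolution F μ {x₀}ᶜ V := by
    refine ⟨hVc.continuousOn.upperSemicontinuousOn, fun y hy ψ hψ hψmax => ?_⟩
    rcases (hVd y).eq_or_lt with heq | hlt'
    · refine hd.2 y hy ψ hψ ?_
      filter_upwards [hψmax] with z hz
      linarith [hVd z]
    · have hyB : y ∈ Metric.closedBall x r := by
        by_contra hyB
        simp only [hV, if_neg hyB, lt_irrefl] at hlt'
      have hVy : V y = b y := by
        simp only [hV, if_pos hyB] at hlt' ⊢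
        exact max_eq_right_of_lt ((lt_max_iff.1 hlt').resolve_left (lt_irrefl _))
      have hyr := hbd y hyB (hVy ▸ hlt')
      have hlm : IsLocalMax (fun z => b z + -1 * ψ z) y := by
        filter_upwards [hψmax, Metric.closedBall_mem_nhds_of_mem
          (by simpa [dist_eq_norm] using (by linarith : ‖y - x‖ < r))] with z hz hzB
        linarith [hVb z hzB]
      have hgb : HasGradientAt b (gradient φ y + (-1 : ℝ) • (2 : ℝ) • (y - x)) y := by
        have h := (hasGradientAt_add_norm_sub_sq (hball hyB).1.2.1 (-1) x).fun_add
          (hasGradientAt_const y (d x - φ x + (r / 2) ^ 2))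
        rwa [add_zero] at h
      have hg := hgb.fun_add
        ((hψ.differentiableAt one_ne_zero).hasGradientAt.fun_const_mul (-1))
      have hzero := hlm.hasFDerivAt_eq_zero (hasGradientAt_iff_hasFDerivAt.1 hg)
      rw [map_eq_zero_iff _ (InnerProductSpace.toDual ℝ _).injective,
        neg_one_smul ℝ (gradient ψ y), add_neg_eq_zero] at hzero
      rw [← hzero]
      exact (hball hyB).2.le
  have hVx₀ : V x₀ = d x₀ := by
    have : x₀ ∉ Metric.closedBall x r := fun h => (hball h).1.1 rfl
    simp only [hV, if_neg this]
  have hxB := Metric.mem_closedBall_self (x := x) hr.le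
  have h1 := (hVb x hxB).trans (hmax V hVc hVx₀ hVs x)
  simp only [hb, sub_self, norm_zero] at h1
  linarith [pow_pos (half_pos hr) 2]

/-- The maximal subsolution vanishing at `x₀` solves the equation off `x₀`. -/
theorem exists_maximal_viscositySolution (hF : Continuous (fun z :
      EuclideanSpace ℝ (Fin n) × EuclideanSpace ℝ (Fin n) => F z.1 z.2))
    (hL0 : 0 ≤ L) (hL : ∀ q y, F q y ≤ μ → ‖q‖ ≤ L) {W : EuclideanSpace ℝ (Fin n) → ℝ}
    (hWc : Continuous W) (hW0 : W x₀ = 0) (hWs : IsViscositySubsolution F μ {x₀}ᶜ W) :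
    ∃ d, Continuous d ∧ IsViscositySolution F μ {x₀}ᶜ d ∧ d x₀ = 0 ∧ W ≤ d := by
  set S : Set (EuclideanSpace ℝ (Fin n) → ℝ) :=
    {v | Continuous v ∧ v x₀ = 0 ∧ IsViscositySubsolution F μ {x₀}ᶜ v} with hS
  have hlip : ∀ v ∈ S, ∀ a b, v b - v a ≤ L * ‖b - a‖ := fun v hv =>
    hv.2.2.sub_le_mul_norm hL0 hL hv.1
  have hWS : W ∈ S := ⟨hWc, hW0, hWs⟩
  have hex : ∀ y, ∃ t, IsLUB ((fun v => v y) '' S) t := fun y => by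
    refine Real.exists_isLUB ⟨_, W, hWS, rfl⟩ ⟨L * ‖y - x₀‖, ?_⟩
    rintro _ ⟨v, hv, rfl⟩
    simpa [hv.2.1] using hlip v hv x₀ y
  choose d hd using hex
  have hle : ∀ v ∈ S, v ≤ d := fun v hv y => (hd y).1 ⟨v, hv, rfl⟩
  have hdl : ∀ a b, d b - d a ≤ L * ‖b - a‖ := fun a b => by
    rw [sub_le_iff_le_add]
    refine (hd b).2 ?_
    rintro _ ⟨v, hv, rfl⟩
    have := hlip v hv a b
    have := hle v hv a
    simp only
    linarith
  have hdc : Continuous d := by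
    refine (LipschitzWith.of_le_add_mul (K := L.toNNReal) (f := d) fun a b => ?_).continuous
    rw [Real.coe_toNNReal _ hL0, dist_eq_norm]
    linarith [hdl b a]
  have hd0 : d x₀ = 0 := by
    refine le_antisymm ((hd x₀).2 ?_) (hW0 ▸ hle W hWS x₀)
    rintro _ ⟨v, hv, rfl⟩
    exact hv.2.1.le
  have hds : IsViscositySubsolution F μ {x₀}ᶜ d :=
    .of_isLUB hF isOpen_compl_singleton (fun v hv => hv.1) (fun v hv => hv.2.2) hd hdc
  exact ⟨d, hdc, ⟨hds, .of_maximal hF hdc hds fun v hvc hv0 hvs =>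
    hle v ⟨hvc, hv0.trans hd0, hvs⟩⟩, hd0, hle W hWS⟩

end Perron

/-! ### The metric problem -/

section MetricProblem

variable {n : ℕ} {H : EuclideanSpace ℝ (Fin n) → EuclideanSpace ℝ (Fin n) → ℝ}

theorem exists_strict_subsolution_of_effectiveHamiltonian_lt {C : ℝ}
    {p : EuclideanSpace ℝ (Fin n)} (hC : ∀ y, H p y ≤ C) {μ : ℝ}
    (hμ : effectiveHamiltonian H p < μ) :
    ∃ μ' < μ, ∃ w : EuclideanSpace ℝ (Fin n) → ℝ, Continuous w ∧
      IsViscositySubsolution (fun q y => H (p + q) y) μ' univ w ∧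
      Tendsto (fun y => ‖y‖⁻¹ * w y) (cocompact (EuclideanSpace ℝ (Fin n))) (𝓝 0) := by
  obtain ⟨μ', ⟨w, ⟨K, hK⟩, hw, hlim⟩, hlt⟩ := exists_lt_of_csInf_lt (by
    -- The zero function at level `C` shows that the set is nonempty, so its infimum is not a
    -- default value of `sInf ∅`.
    refine ⟨C, fun _ => 0, ⟨0, LipschitzWith.const 0⟩, ⟨upperSemicontinuousOn_const, ?_⟩,
      by simpa using tendsto_const_nhds⟩
    intro x _ φ hφ hmax
    have h := ((hasGradientAt_const x (0 : ℝ)).fun_add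
      ((hφ.differentiableAt one_ne_zero).hasGradientAt.fun_const_mul (-1)))
    have hzero := IsLocalMax.hasFDerivAt_eq_zero (by simpa [sub_eq_add_neg] using hmax)
      (hasGradientAt_iff_hasFDerivAt.1 h)
    rw [map_eq_zero_iff _ (InnerProductSpace.toDual ℝ _).injective, zero_add, neg_one_smul,
      neg_eq_zero] at hzero
    simpa [hzero] using hC x) hμ
  exact ⟨μ', hlt, w, hK.continuous, hw, hlim⟩

theorem exists_norm_le_of_coercive
    (hcoercive : Tendsto (fun q => ⨅ y, (H q y : EReal))
      (cocompact (EuclideanSpace ℝ (Fin n))) (𝓝 ⊤)) (p : EuclideanSpace ℝ (Fin n)) (μ : ℝ) :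
    ∃ L > 0, ∀ q y, H (p + q) y ≤ μ → ‖q‖ ≤ L := by
  obtain ⟨K, hK, hKs⟩ := mem_cocompact.1
    (hcoercive.eventually (lt_mem_nhds (EReal.coe_lt_top μ)))
  obtain ⟨R, hR⟩ := hK.isBounded.exists_norm_le
  refine ⟨|R| + ‖p‖ + 1, by positivity, fun q y hq => ?_⟩
  have hmem : p + q ∈ K := by
    by_contra hnot
    have h1 : (μ : EReal) < ⨅ y, (H (p + q) y : EReal) := hKs hnot
    exact absurd hq (not_le.2 (EReal.coe_lt_coe_iff.1 (h1.trans_le (iInf_le _ y))))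
  have h2 : ‖q‖ ≤ ‖p + q‖ + ‖p‖ := by simpa using norm_sub_le (p + q) p
  linarith [hR _ hmem, le_abs_self R]

theorem uniformContinuousOn_translate
    (hH : ∀ R : ℝ, 0 < R → UniformContinuousOn
      (fun z : EuclideanSpace ℝ (Fin n) × EuclideanSpace ℝ (Fin n) => H z.1 z.2)
      (Metric.ball 0 R ×ˢ univ)) (p : EuclideanSpace ℝ (Fin n)) {R : ℝ} (hR : 0 < R) :
    UniformContinuousOn (fun z : EuclideanSpace ℝ (Fin n) × EuclideanSpace ℝ (Fin n) =>
      H (p + z.1) z.2) (Metric.ball 0 R ×ˢ univ) := by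
  have hmaps : UniformContinuous (fun z : EuclideanSpace ℝ (Fin n) × EuclideanSpace ℝ (Fin n) =>
      (p + z.1, z.2)) :=
    (uniformContinuous_const.add uniformContinuous_fst).prodMk uniformContinuous_snd
  refine (hH (‖p‖ + R) (by positivity)).comp hmaps.uniformContinuousOn ?_
  rintro ⟨q, y⟩ ⟨hq, -⟩
  exact ⟨by simpa using (norm_add_le p q).trans_lt (by simpa using hq), mem_univ _⟩

theorem continuous_of_uniformContinuousOn
    (hH : ∀ R : ℝ, 0 < R → UniformContinuousOn
      (fun z : EuclideanSpace ℝ (Fin n) × EuclideanSpace ℝ (Fin n) => H z.1 z.2)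
      (Metric.ball 0 R ×ˢ univ)) :
    Continuous (fun z : EuclideanSpace ℝ (Fin n) × EuclideanSpace ℝ (Fin n) => H z.1 z.2) := by
  refine continuous_iff_continuousAt.2 fun z => ?_
  refine (hH (‖z.1‖ + 1) (by positivity)).continuousOn.continuousAt
    ((Metric.isOpen_ball.prod isOpen_univ).mem_nhds ⟨by simp, mem_univ _⟩)

theorem exists_eventually_mul_norm_le_of_liminf_pos {d : EuclideanSpace ℝ (Fin n) → ℝ}
    (hd : 0 < liminf (fun y => ((‖y‖⁻¹ * d y : ℝ) : EReal))
      (cocompact (EuclideanSpace ℝ (Fin n)))) :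
    ∃ a > 0, ∀ᶠ y in cocompact (EuclideanSpace ℝ (Fin n)), a * ‖y‖ ≤ d y := by
  obtain ⟨a, ha0, ha⟩ := EReal.lt_iff_exists_real_btwn.1 hd
  refine ⟨a, EReal.coe_pos.1 ha0, ?_⟩
  filter_upwards [eventually_lt_of_lt_liminf ha,
    (tendsto_norm_cocompact_atTop (E := EuclideanSpace ℝ (Fin n))).eventually
      (eventually_gt_atTop 0)] with y hy hy0
  have := EReal.coe_lt_coe_iff.1 hy
  rw [lt_inv_mul_iff₀ hy0] at this
  linarith

theorem liminf_pos_of_eventually_mul_norm_le {d : EuclideanSpace ℝ (Fin n) → ℝ} {a : ℝ}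
    (ha : 0 < a) (hd : ∀ᶠ y in cocompact (EuclideanSpace ℝ (Fin n)), a * ‖y‖ ≤ d y) :
    0 < liminf (fun y => ((‖y‖⁻¹ * d y : ℝ) : EReal))
      (cocompact (EuclideanSpace ℝ (Fin n))) := by
  refine (EReal.coe_pos.2 ha).trans_le (le_liminf_of_le (by isBoundedDefault) ?_)
  filter_upwards [hd, (tendsto_norm_cocompact_atTop (E := EuclideanSpace ℝ (Fin n))).eventually
    (eventually_gt_atTop 0)] with y hy hy0
  rw [EReal.coe_le_coe_iff, le_inv_mul_iff₀ hy0]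
  linarith

end MetricProblem

theorem proposition3p3 (n : ℕ) (hn : 1 ≤ n)
    (H : EuclideanSpace ℝ (Fin n) → EuclideanSpace ℝ (Fin n) → ℝ)
    (hconvex : ∀ y, ConvexOn ℝ univ (fun q => H q y))
    (hcoercive : Tendsto (fun q => ⨅ y, (H q y : EReal))
      (cocompact (EuclideanSpace ℝ (Fin n))) (𝓝 ⊤))
    (hregular : ∀ R : ℝ, 0 < R →
      UniformContinuousOn (fun z : EuclideanSpace ℝ (Fin n) × EuclideanSpace ℝ (Fin n) =>
        H z.1 z.2) (Metric.ball 0 R ×ˢ univ) ∧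
      ∃ C : ℝ, ∀ q ∈ Metric.ball (0 : EuclideanSpace ℝ (Fin n)) R, ∀ y, |H q y| ≤ C)
    (p : EuclideanSpace ℝ (Fin n)) (μ : ℝ) (hμ : effectiveHamiltonian H p < μ)
    (x₀ : EuclideanSpace ℝ (Fin n)) :
    ∃! d : EuclideanSpace ℝ (Fin n) → ℝ,
      Continuous d ∧
      IsViscositySolution (fun q y => H (p + q) y) μ {x₀}ᶜ d ∧
      0 < liminf (fun y => ((‖y‖⁻¹ * d y : ℝ) : EReal))
        (cocompact (EuclideanSpace ℝ (Fin n))) ∧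
      d x₀ = 0 := by
  obtain ⟨-, C, hC⟩ := hregular (‖p‖ + 1) (by positivity)
  obtain ⟨μ₁, hμ₁, w, hwc, hws, hw⟩ := exists_strict_subsolution_of_effectiveHamiltonian_lt
    (fun y => (le_abs_self _).trans (hC p (by simp) y)) hμ
  obtain ⟨L, hL0, hL⟩ := exists_norm_le_of_coercive hcoercive p μ
  have hF := fun R hR =>
    uniformContinuousOn_translate (fun R hR => (hregular R hR).1) p (R := R) hR
  have hFc := continuous_of_uniformContinuousOn (H := fun q y => H (p + q) y) hF
  have hFconv : ∀ y, ConvexOn ℝ univ (fun q => H (p + q) y) := fun y => by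
    simpa [Function.comp_def] using (hconvex y).translate_right p
  -- The gap from `μ₁` to `μ₂` pays for the perturbation of size `δ`; the gap from `μ₂` to `μ` keeps
  -- it strict.
  obtain ⟨μ₂, h12, hμ₂⟩ := exists_between hμ₁
  obtain ⟨δ, hδ, hδF⟩ := exists_forall_add_le_of_uniformContinuousOn
    (F := fun q y => H (p + q) y) hF hL0.le (fun q y hq => hL q y (hq.trans hμ₁.le)) h12
  have hpert : ∀ κ : ℝ, 0 ≤ κ → IsViscositySubsolution (fun q y => H (p + q) y) μ₂ univ
      (fun y => w y + δ * truncatedNorm κ y) := fun κ hκ => by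
    refine hws.add_contDiff (δ := δ) (contDiff_const.mul (contDiff_truncatedNorm hκ))
      (fun x => ?_) hδF
    obtain ⟨v, hv, hg⟩ := hasGradientAt_truncatedNorm hκ x
    refine ⟨δ • v, ?_, hg.fun_const_mul δ⟩
    rw [norm_smul, Real.norm_of_nonneg hδ.le]
    nlinarith
  set W : EuclideanSpace ℝ (Fin n) → ℝ := fun y =>
    (w y + δ * truncatedNorm 0 y) + -(w x₀ + δ * truncatedNorm 0 x₀) with hW
  have hWc : Continuous W := (hwc.add (continuous_const.mul
    (contDiff_truncatedNorm le_rfl).continuous)).add continuous_const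
  have hWs : IsViscositySubsolution (fun q y => H (p + q) y) μ {x₀}ᶜ W := by
    refine (((hpert 0 le_rfl).add_contDiff (δ := 0) contDiff_const
      (fun x => ⟨0, by simp, hasGradientAt_const x _⟩) fun q y e hq he => ?_).mono
      (subset_univ _) hμ₂.le)
    rwa [norm_le_zero_iff.1 he, add_zero]
  obtain ⟨d, hdc, hds, hd0, hWd⟩ := exists_maximal_viscositySolution hFc hL0.le hL hWc
    (by simp [hW]) hWs
  -- Of the slope `δ`, at most `δ / 2` is lost to `w` and `δ / 4` to the normalising constant.
  have hdpos := liminf_pos_of_eventually_mul_norm_le (d := d) (a := δ / 4) (by positivity) (by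
    filter_upwards [eventually_abs_le_mul_norm hw (half_pos hδ),
      eventually_le_mul_norm (w x₀ + δ * truncatedNorm 0 x₀) (a := δ / 4) (by positivity)]
      with y h1 h2
    have h3 := hWd y
    have h4 := mul_le_mul_of_nonneg_left (norm_le_truncatedNorm_zero y) hδ.le
    simp only [hW] at h3
    linarith [neg_abs_le (w y)])
  have hle : ∀ u v : EuclideanSpace ℝ (Fin n) → ℝ,
      (Continuous u ∧ IsViscositySolution (fun q y => H (p + q) y) μ {x₀}ᶜ u ∧
        0 < liminf (fun y => ((‖y‖⁻¹ * u y : ℝ) : EReal))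
          (cocompact (EuclideanSpace ℝ (Fin n))) ∧ u x₀ = 0) →
      (Continuous v ∧ IsViscositySolution (fun q y => H (p + q) y) μ {x₀}ᶜ v ∧
        0 < liminf (fun y => ((‖y‖⁻¹ * v y : ℝ) : EReal))
          (cocompact (EuclideanSpace ℝ (Fin n))) ∧ v x₀ = 0) → u ≤ v := by
    rintro u v ⟨huc, hus, -, hu0⟩ ⟨hvc, hvs, hvpos, hv0⟩
    obtain ⟨a, ha, hgrowth⟩ := exists_eventually_mul_norm_le_of_liminf_pos hvpos
    exact hvs.2.ge_of_subsolution hFconv hF hL0 hL hμ₂ hδ hus.1 hpert huc hvc hwc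
      (fun a b => hvs.1.sub_le_mul_norm hL0.le hL hvc a b) hu0 hv0 hw ha hgrowth
  exact ⟨d, ⟨hdc, hds, hdpos, hd0⟩, fun u hu =>
    le_antisymm (hle u d hu ⟨hdc, hds, hdpos, hd0⟩) (hle d u ⟨hdc, hds, hdpos, hd0⟩ hu)⟩
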